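/- Let $p>3$ be a prime and let $\mathbb Z_p$ denote the ring of rational numbers whose denominator is not divisible by $p$; congruences modulo $p$ and $p^2$ are taken in this ring. Let $a\in\mathbb Z_p$ with $a\not\equiv 0\pmod p$, let $\langle a\rangle_p\in\{0,1,\ldots,p-1\}$ be given by $a\equiv\langle a\rangle_p\pmod p$, and put $t=(a-\langle a\rangle_p)/p$. Let $\binom xk=\frac{x(x-1)\cdots(x-k+1)}{k!}$, and let the Euler numbers and Euler polynomials be defined by $E_0=1$, $E_n=-\sum_{k=1}^{\lfloor n/2\rfloor}\binom n{2k}E_{n-2k}$ $(n\ge 1)$ and $E_n(x)=\frac1{2^n}\sum_{r=0}^n\binom nr(2x-1)^{n-r}E_r$ $(n\ge 0)$. Then $$\sum_{k=0}^{(p-1)/2}k\binom ak\binom{-1-a}k\equiv\begin{cases}(-1)^{\langle a\rangle_p}a(a+1)-\frac12pt\bigl(2a(a+1)E_{p-2}(-a)+2a+1\bigr)\pmod{p^2}&\text{if }\langle a\rangle_p\le\frac{p-1}2,\\[4pt](-1)^{\langle a\rangle_p}a(a+1)-\frac12p(t+1)\bigl(2a(a+1)E_{p-2}(-a)+2a+1\bigr)\pmod{p^2}&\text{if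 }\langle a\rangle_p>\frac{p-1}2.\end{cases}$$ -/

import Mathlib

namespace SunCongruence

/-- Euler numbers: `E 0 = 1` and `E n = -∑_{k=1}^{⌊n/2⌋} C(n,2k) E (n-2k)` for `n ≥ 1`
(the index `k : Fin ((n + 1) / 2)` below stands for `k + 1`). -/
def eulerNumber : ℕ → ℤ
  | 0 => 1
  | n + 1 => -∑ k : Fin ((n + 1) / 2),
      ((n + 1).choose (2 * (k.val + 1)) : ℤ) * eulerNumber (n + 1 - 2 * (k.val + 1))
termination_by n => n
decreasing_by omega

theorem eulerNumber_zero : eulerNumber 0 = 1 := by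
  rw [eulerNumber]

/-- The recursion for the Euler numbers in its usual form. -/
theorem eulerNumber_rec (n : ℕ) (hn : 1 ≤ n) :
    eulerNumber n =
      -∑ k ∈ Finset.Icc 1 (n / 2), (n.choose (2 * k) : ℤ) * eulerNumber (n - 2 * k) := by
  obtain ⟨m, rfl⟩ : ∃ m, n = m + 1 := ⟨n - 1, by omega⟩
  rw [eulerNumber, Fin.sum_univ_eq_sum_range
    (fun k => ((m + 1).choose (2 * (k + 1)) : ℤ) * eulerNumber (m + 1 - 2 * (k + 1))),
    Finset.range_eq_Ico, Finset.sum_Ico_add'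
    (fun k => ((m + 1).choose (2 * k) : ℤ) * eulerNumber (m + 1 - 2 * k))]
  rfl

/-- The value at `x` of the Euler polynomial,
`E_n(x) = 2⁻ⁿ ∑_{r=0}^{n} C(n,r) (2x-1)^{n-r} E_r`. -/
def eulerPoly (n : ℕ) (x : ℚ) : ℚ :=
  1 / 2 ^ n * ∑ r ∈ Finset.range (n + 1),
    (n.choose r : ℚ) * (2 * x - 1) ^ (n - r) * (eulerNumber r : ℚ)

/-- `x` is a rational `p`-adic integer: its reduced denominator is not divisible by `p`. -/
def IsPInt (p : ℕ) (x : ℚ) : Prop := ¬ p ∣ x.den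

/-- Congruence modulo `m` in the ring of rational `p`-adic integers: both sides lie in that ring
and differ by `m` times an element of it. -/
def Congr (p m : ℕ) (x y : ℚ) : Prop :=
  IsPInt p x ∧ IsPInt p y ∧ ∃ c : ℚ, IsPInt p c ∧ x - y = m * c

/-- The least nonnegative residue modulo `p` of a rational `p`-adic integer. -/
def residue (p : ℕ) (a : ℚ) : ℕ := ((a.num : ZMod p) * (a.den : ZMod p)⁻¹).val

theorem residue_lt (p : ℕ) (hp : p.Prime) (a : ℚ) : residue p a < p := by
  have : NeZero p := ⟨hp.ne_zero⟩
  exact ZMod.val_lt _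

theorem congr_residue (p : ℕ) (hp : p.Prime) (a : ℚ) (ha : IsPInt p a) :
    Congr p p a (residue p a) := by
  have : Fact p.Prime := ⟨hp⟩
  have hd : (a.den : ZMod p) ≠ 0 := by
    rwa [Ne, ZMod.natCast_eq_zero_iff]
  have h0 : ((a.num - a.den * residue p a : ℤ) : ZMod p) = 0 := by
    rw [residue, Int.cast_sub, Int.cast_mul, Int.cast_natCast, Int.cast_natCast,
      ZMod.natCast_zmod_val]
    rw [mul_comm (a.num : ZMod p), mul_inv_cancel_left₀ hd, sub_self]
  obtain ⟨c, hc⟩ := (ZMod.intCast_zmod_eq_zero_iff_dvd _ p).1 h0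
  refine ⟨ha, by simp [IsPInt, hp.one_lt.ne'], (c : ℚ) / a.den, fun h => ha (h.trans ?_), ?_⟩
  · have := Rat.den_dvd c a.den
    rw [Rat.divInt_eq_div] at this
    exact_mod_cast this
  · have hq : (a.den : ℚ) ≠ 0 := by exact_mod_cast a.den_nz
    have hc' : (a.num : ℚ) - a.den * residue p a = p * c := by exact_mod_cast hc
    have hn : a * a.den = a.num := Rat.mul_den_eq_num a
    rw [← mul_div_assoc, eq_div_iff hq, ← hc', ← hn]
    ring

end SunCongruence

/-! Put n = (p-1)/2, and let G and F be n!² times the plain and the weighted sum up to n, so that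
both are polynomials without denominators and make sense over ℤ, ℚ, the `p`-adic integers and `ZMod
p`. Telescoping gives F = x(x+1)G + W, with W the product `chooseProd x (n + 1)`.

Write a = m + pT for an integer m at which G(m) = n!²·(±1) and W(m) = 0 hold exactly. A Taylor
expansion at m modulo p² then needs only F'(m) modulo p, hence G' and W' modulo p. The identity G(x)
+ G(x-1) = 2 · `oddProd x n`, where `oddProd` reduces to n!²(1 - x^(p-1)), differentiates to a
first-order difference equation for G'. The function -n!² E_{p-2}(-x) satisfies the same equation,
and on `ZMod p` its solution is unique because p is odd. The factored form of W gives W' directly.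
Finally n!² is a unit at p and is divided out. -/

namespace SunCongruence
open Polynomial Finset

/-! ### Denominator-free sums and their identities over any commutative ring -/

section Sums

variable {R S : Type*} [CommRing R] [CommRing S]

/-- `k!²` times `choose x k * choose (-1 - x) k`. -/
def chooseProd (x : R) (k : ℕ) : R := ∏ i ∈ range k, (x - i) * (-1 - x - i)

/-- `k!²` times `choose (x - 1) k * choose (-x - 1) k`. -/
def oddProd (x : R) (k : ℕ) : R := ∏ i ∈ range k, (x - (i + 1)) * (-x - (i + 1))

/-- `n!²` times `∑ k ≤ n, choose x k * choose (-1 - x) k`. -/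
def scaledSum (x : R) : ℕ → R
  | 0 => 1
  | n + 1 => (n + 1) ^ 2 * scaledSum x n + chooseProd x (n + 1)

/-- `n!²` times `∑ k ≤ n, k * choose x k * choose (-1 - x) k`. -/
def scaledWeightedSum (x : R) : ℕ → R
  | 0 => 0
  | n + 1 => (n + 1) ^ 2 * scaledWeightedSum x n + (n + 1) * chooseProd x (n + 1)

theorem map_chooseProd (f : R →+* S) (x : R) (k : ℕ) :
    f (chooseProd x k) = chooseProd (f x) k := by
  simp [chooseProd]

theorem map_oddProd (f : R →+* S) (x : R) (k : ℕ) : f (oddProd x k) = oddProd (f x) k := by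
  simp [oddProd]

theorem map_scaledSum (f : R →+* S) (x : R) (n : ℕ) :
    f (scaledSum x n) = scaledSum (f x) n := by
  induction n with
  | zero => simp [scaledSum]
  | succ n ih => simp [scaledSum, map_chooseProd, ih]

theorem map_scaledWeightedSum (f : R →+* S) (x : R) (n : ℕ) :
    f (scaledWeightedSum x n) = scaledWeightedSum (f x) n := by
  induction n with
  | zero => simp [scaledWeightedSum]
  | succ n ih => simp [scaledWeightedSum, map_chooseProd, ih]

theorem chooseProd_succ (x : R) (k : ℕ) :
    chooseProd x (k + 1) = chooseProd x k * ((x - k) * (-1 - x - k)) :=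
  prod_range_succ _ _

theorem oddProd_succ (x : R) (k : ℕ) :
    oddProd x (k + 1) = oddProd x k * ((x - (k + 1)) * (-x - (k + 1))) :=
  prod_range_succ _ _

theorem chooseProd_neg_one_sub (x : R) (k : ℕ) : chooseProd (-1 - x) k = chooseProd x k := by
  unfold chooseProd
  refine prod_congr rfl fun i _ => ?_
  ring

theorem scaledSum_neg_one_sub (x : R) (n : ℕ) : scaledSum (-1 - x) n = scaledSum x n := by
  induction n with
  | zero => rfl
  | succ n ih => rw [scaledSum, scaledSum, ih, chooseProd_neg_one_sub]

/-- The next two lemmas regroup the same linear factors, so that the products at x and x - 1 share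
the factor `oddProd x n`. -/
theorem chooseProd_succ_eq_oddProd (x : R) (n : ℕ) :
    chooseProd x (n + 1) = -x * (x + n + 1) * oddProd x n := by
  induction n with
  | zero => simp [chooseProd, oddProd]; ring
  | succ n ih => rw [chooseProd_succ, ih, oddProd_succ]; push_cast; ring

theorem chooseProd_sub_one_succ_eq_oddProd (x : R) (n : ℕ) :
    chooseProd (x - 1) (n + 1) = -x * (x - n - 1) * oddProd x n := by
  induction n with
  | zero => simp [chooseProd, oddProd]; ring
  | succ n ih => rw [chooseProd_succ, ih, oddProd_succ]; push_cast; ring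

/-- The sum telescopes because (x-k)(-1-x-k) = k(k+1) - x(x+1). -/
theorem scaledWeightedSum_eq (x : R) (n : ℕ) :
    scaledWeightedSum x n = x * (x + 1) * scaledSum x n + chooseProd x (n + 1) := by
  induction n with
  | zero => simp [scaledWeightedSum, scaledSum, chooseProd]; ring
  | succ n ih =>
    rw [scaledWeightedSum, scaledSum, ih, chooseProd_succ x (n + 1)]
    push_cast
    ring

/-- In the inductive step the two new products add up to -2x² `oddProd x n`, and (n+1)² - x² is
exactly the next factor of `oddProd`. -/
theorem scaledSum_add_scaledSum_sub_one (x : R) (n : ℕ) :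
    scaledSum x n + scaledSum (x - 1) n = 2 * oddProd x n := by
  induction n with
  | zero => simp [scaledSum, oddProd]; norm_num
  | succ n ih =>
    have h : scaledSum x (n + 1) + scaledSum (x - 1) (n + 1) =
        (n + 1) ^ 2 * (scaledSum x n + scaledSum (x - 1) n)
          + (chooseProd x (n + 1) + chooseProd (x - 1) (n + 1)) := by
      rw [scaledSum, scaledSum]; ring
    rw [h, ih, chooseProd_succ_eq_oddProd, chooseProd_sub_one_succ_eq_oddProd, oddProd_succ]
    ring

theorem chooseProd_natCast_eq_zero {m k : ℕ} (h : m < k) : chooseProd (m : R) k = 0 :=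
  prod_eq_zero (mem_range.2 h) (by simp)

theorem oddProd_natCast_eq_zero {m k : ℕ} (h0 : 0 < m) (h : m ≤ k) : oddProd (m : R) k = 0 := by
  obtain ⟨i, rfl⟩ : ∃ i, m = i + 1 := ⟨m - 1, by omega⟩
  exact prod_eq_zero (mem_range.2 h) (by simp)

theorem oddProd_neg (x : R) (k : ℕ) : oddProd (-x) k = oddProd x k := by
  unfold oddProd
  refine prod_congr rfl fun i _ => ?_
  ring

theorem oddProd_zero (k : ℕ) : oddProd (0 : R) k = (k.factorial : R) ^ 2 := by
  induction k with
  | zero => simp [oddProd]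
  | succ k ih => rw [oddProd_succ, ih, Nat.factorial_succ]; push_cast; ring

theorem scaledSum_zero (n : ℕ) : scaledSum (0 : R) n = (n.factorial : R) ^ 2 := by
  induction n with
  | zero => simp [scaledSum]
  | succ n ih =>
    have h := chooseProd_natCast_eq_zero (R := R) (Nat.succ_pos n)
    rw [Nat.cast_zero] at h
    rw [scaledSum, ih, h, Nat.factorial_succ]
    push_cast
    ring

/-- For 1 ≤ m ≤ n the right side of the difference equation vanishes, so each unit step from 0 flips
the sign. -/
theorem scaledSum_natCast {m n : ℕ} (h : m ≤ n) :
    scaledSum (m : R) n = (n.factorial : R) ^ 2 * (-1) ^ m := by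
  induction m with
  | zero => simp [scaledSum_zero]
  | succ m ih =>
    have h1 := scaledSum_add_scaledSum_sub_one ((m + 1 : ℕ) : R) n
    rw [oddProd_natCast_eq_zero (Nat.succ_pos m) h] at h1
    have h2 : ((m + 1 : ℕ) : R) - 1 = m := by push_cast; ring
    rw [h2, ih (by omega)] at h1
    rw [pow_succ]
    linear_combination h1

theorem scaledWeightedSum_eq_sum {K : Type*} [Field K] [CharZero K] [BinomialRing K]
    (x : K) (n : ℕ) :
    scaledWeightedSum x n = (n.factorial : K) ^ 2 *
      ∑ k ∈ range (n + 1), (k : K) * Ring.choose x k * Ring.choose (-1 - x) k := by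
  have key (y : K) (k : ℕ) : (k.factorial : K) * Ring.choose y k = ∏ i ∈ range k, (y - i) := by
    have := Ring.descPochhammer_eq_factorial_smul_choose y k
    rw [nsmul_eq_mul] at this
    rw [← this, ← Polynomial.aeval_eq_smeval, Polynomial.aeval_def, ← Polynomial.eval_map,
      descPochhammer_map, descPochhammer_eval_eq_prod_range]
  have key2 (k : ℕ) : chooseProd x k =
      (k.factorial : K) ^ 2 * (Ring.choose x k * Ring.choose (-1 - x) k) := by
    rw [chooseProd, prod_mul_distrib, ← key, ← key]
    ring
  induction n with
  | zero => simp [scaledWeightedSum]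
  | succ n ih =>
    rw [scaledWeightedSum, ih, key2, sum_range_succ _ (n + 1), Nat.factorial_succ]
    push_cast
    ring

end Sums

/-! ### Euler polynomials and their difference equation -/

section Euler

variable {R S : Type*} [CommRing R] [CommRing S]

/-- `2 ^ n` times the Euler polynomial, as a function of `y = 2 * x - 1`. -/
def scaledEuler (n : ℕ) (y : R) : R :=
  ∑ r ∈ range (n + 1), (n.choose r : R) * y ^ (n - r) * (eulerNumber r : R)

theorem map_scaledEuler (f : R →+* S) (n : ℕ) (y : R) :
    f (scaledEuler n y) = scaledEuler n (f y) := by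
  simp [scaledEuler]

theorem eulerPoly_eq (n : ℕ) (x : ℚ) :
    eulerPoly n x = 1 / 2 ^ n * scaledEuler n (2 * x - 1) := rfl

/-- The umbral functional `X ^ r ↦ E_r`. -/
noncomputable def eulerFunctional (R : Type*) [CommRing R] : R[X] →ₗ[R] R :=
  Polynomial.lsum fun r => (eulerNumber r : R) • LinearMap.id

theorem eulerFunctional_C_mul_X_pow (c : R) (r : ℕ) :
    eulerFunctional R (C c * X ^ r) = c * eulerNumber r := by
  rw [C_mul_X_pow_eq_monomial, eulerFunctional, Polynomial.lsum_apply,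
    sum_monomial_index c _ (by simp), LinearMap.smul_apply, LinearMap.id_apply, smul_eq_mul,
    mul_comm]

theorem eulerFunctional_X_add_C_pow (n : ℕ) (y : R) :
    eulerFunctional R ((X + C y) ^ n) = scaledEuler n y := by
  rw [add_pow, map_sum, scaledEuler]
  refine sum_congr rfl fun r _ => ?_
  rw [show (X : R[X]) ^ r * C y ^ (n - r) * (n.choose r : R[X])
    = C ((n.choose r : R) * y ^ (n - r)) * X ^ r by
      rw [C_mul, C_pow, C_eq_natCast]; ring, eulerFunctional_C_mul_X_pow]

theorem sum_choose_mul_eulerNumber_eq_zero {n : ℕ} (hn : n ≠ 0) :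
    ∑ k ∈ range (n / 2 + 1), (n.choose (2 * k) : ℤ) * eulerNumber (n - 2 * k) = 0 := by
  rw [range_eq_Ico, sum_eq_sum_Ico_succ_bot (Nat.succ_pos _)]
  have hrec := eulerNumber_rec n (by omega)
  rw [show Ico (0 + 1) (n / 2 + 1) = Icc 1 (n / 2) by ext; simp]
  simp only [mul_zero, Nat.choose_zero_right, Nat.cast_one, Nat.sub_zero, one_mul]
  linarith

/-- The odd powers of -1 cancel, and what remains is twice the defining recursion of the Euler
numbers. -/
theorem scaledEuler_one_add_neg_one (n : ℕ) :
    scaledEuler n (1 : R) + scaledEuler n (-1) = if n = 0 then 2 else 0 := by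
  split_ifs with h
  · subst h
    simp [scaledEuler, eulerNumber_zero]
    norm_num
  · suffices scaledEuler n (1 : ℤ) + scaledEuler n (-1) = 0 by
      simpa only [map_add, map_scaledEuler, map_one, map_neg, map_zero] using
        congrArg (Int.castRingHom R) this
    have hodd : scaledEuler n (1 : ℤ) + scaledEuler n (-1) =
        2 * ∑ j ∈ range (n + 1) with Even j, (n.choose j : ℤ) * eulerNumber (n - j) := by
      rw [scaledEuler, scaledEuler, ← sum_add_distrib, ← sum_range_reflect, sum_filter, mul_sum]
      refine sum_congr rfl fun j hj => ?_
      have hj' : j ≤ n := Nat.lt_succ_iff.1 (mem_range.1 hj)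
      rw [show n + 1 - 1 - j = n - j by omega, Nat.sub_sub_self hj', Nat.choose_symm hj']
      rw [Int.cast_id]
      split_ifs with hp
      · rw [hp.neg_one_pow]; ring
      · rw [(Nat.not_even_iff_odd.1 hp).neg_one_pow]; ring
    rw [hodd, mul_eq_zero, ← sum_choose_mul_eulerNumber_eq_zero h]
    right
    refine sum_nbij' (· / 2) (2 * ·) ?_ ?_ ?_ ?_ ?_
    · simp; omega
    · simp; omega
    · simp only [mem_filter]; rintro j ⟨-, hj⟩; exact Nat.mul_div_cancel' hj.two_dvd
    · simp
    · simp only [mem_filter]; rintro j ⟨-, hj⟩; rw [Nat.mul_div_cancel' hj.two_dvd]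

/-- This is E_n(x) + E_n(x+1) = 2xⁿ with z = 2x. Umbrally, expanding ((X + e) + z)ⁿ in powers of X +
e reduces it to the case z = 0, where only the term of exponent 0 survives. -/
theorem scaledEuler_add_one_add_sub_one (n : ℕ) (z : R) :
    scaledEuler n (z + 1) + scaledEuler n (z - 1) = 2 * z ^ n := by
  have hexp (e : R) : scaledEuler n (z + e) =
      ∑ k ∈ range (n + 1), (z ^ (n - k) * n.choose k) * scaledEuler k e := by
    rw [← eulerFunctional_X_add_C_pow, C_add, add_comm (C z), ← add_assoc, add_pow, map_sum]
    refine sum_congr rfl fun k _ => ?_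
    have : (X + C e) ^ k * C z ^ (n - k) * (n.choose k : R[X]) =
        (z ^ (n - k) * (n.choose k : R)) • (X + C e) ^ k := by
      rw [smul_eq_C_mul, C_mul, C_pow, C_eq_natCast]; ring
    rw [this, map_smul, smul_eq_mul, eulerFunctional_X_add_C_pow]
  rw [sub_eq_add_neg, hexp, hexp, ← sum_add_distrib]
  simp_rw [← mul_add, scaledEuler_one_add_neg_one]
  simp [mul_comm]

end Euler

/-! ### Derivatives modulo p -/

section ModPrime

variable {p : ℕ} [Fact p.Prime]

theorem two_mul_half_add_one {p : ℕ} (hp : p.Prime) (hp3 : 3 < p) : 2 * ((p - 1) / 2) + 1 = p := by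
  have := hp.odd_of_ne_two (by omega)
  obtain ⟨k, rfl⟩ := this
  omega

theorem natDegree_oddProd_X_le {R : Type*} [CommRing R] (n : ℕ) :
    (oddProd (X : R[X]) n).natDegree ≤ 2 * n := by
  induction n with
  | zero => simp [oddProd]
  | succ n ih =>
    rw [oddProd_succ]
    have : ((X - ((n : R[X]) + 1)) * (-X - ((n : R[X]) + 1))).natDegree ≤ 2 := by compute_degree
    exact (natDegree_mul_le_of_le ih this).trans (by omega)

/-- Both sides have degree at most p - 1 and agree at all p points: every nonzero residue is ±i with
1 ≤ i ≤ (p-1)/2, hence a root of both. -/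
theorem oddProd_X_eq (hp3 : 3 < p) :
    oddProd (X : (ZMod p)[X]) ((p - 1) / 2) =
      C ((((p - 1) / 2).factorial : ZMod p) ^ 2) * (1 - X ^ (p - 1)) := by
  have hp : p.Prime := Fact.out
  have hn := two_mul_half_add_one hp hp3
  have hdeg : (oddProd (X : (ZMod p)[X]) ((p - 1) / 2) -
      C ((((p - 1) / 2).factorial : ZMod p) ^ 2) * (1 - X ^ (p - 1))).natDegree ≤ p - 1 := by
    refine (natDegree_sub_le _ _).trans (max_le ?_ ?_)
    · exact (natDegree_oddProd_X_le _).trans (by omega)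
    · refine (natDegree_C_mul_le _ _).trans ?_
      compute_degree
  refine eq_of_degree_sub_lt_of_eval_finset_eq univ
    (lt_of_le_of_lt degree_le_natDegree ?_) fun x _ => ?_
  · rw [card_univ, ZMod.card]
    exact_mod_cast hdeg.trans_lt (by omega)
  · have hev : eval x (oddProd (X : (ZMod p)[X]) ((p - 1) / 2)) = oddProd x ((p - 1) / 2) := by
      simpa using map_oddProd (evalRingHom x) X ((p - 1) / 2)
    rw [hev]
    by_cases hx : x = 0
    · subst hx
      simp [oddProd_zero, show p - 1 ≠ 0 by omega]
    · have h1 : x ^ (p - 1) = 1 := ZMod.pow_card_sub_one_eq_one hx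
      simp only [eval_mul, eval_C, eval_sub, eval_one, eval_pow, eval_X, h1, sub_self, mul_zero]
      have hv : x.val ≠ 0 := by rwa [Ne, ZMod.val_eq_zero]
      have hlt := x.val_lt
      rcases le_or_gt x.val ((p - 1) / 2) with h | h
      · rw [← ZMod.natCast_zmod_val x]
        exact oddProd_natCast_eq_zero (Nat.pos_of_ne_zero hv) h
      · have : x = -((p - x.val : ℕ) : ZMod p) := by
          rw [Nat.cast_sub hlt.le]; simp
        rw [this, oddProd_neg]
        exact oddProd_natCast_eq_zero (by omega) (by omega)

theorem two_ne_zero_zmod (hp3 : 3 < p) : (2 : ZMod p) ≠ 0 := by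
  intro h
  have : ((2 : ℕ) : ZMod p) = 0 := by exact_mod_cast h
  rw [ZMod.natCast_eq_zero_iff] at this
  exact absurd (Nat.le_of_dvd two_pos this) (by omega)

theorem two_pow_sub_two_mul_two (hp3 : 3 < p) : (2 : ZMod p) ^ (p - 2) * 2 = 1 := by
  rw [← pow_succ, show p - 2 + 1 = p - 1 by omega,
    ZMod.pow_card_sub_one_eq_one (two_ne_zero_zmod hp3)]

/-- After p unit steps the argument returns to x while the sign has become (-1)^p = -1. -/
theorem eq_zero_of_add_sub_one_eq_zero (hp3 : 3 < p) (f : ZMod p → ZMod p)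
    (hf : ∀ x, f x + f (x - 1) = 0) (x : ZMod p) : f x = 0 := by
  have hp : p.Prime := Fact.out
  have hk (k : ℕ) : f (x - k) = (-1) ^ k * f x := by
    induction k with
    | zero => simp
    | succ k ih =>
      have := hf (x - k)
      rw [ih, sub_sub] at this
      push_cast
      rw [pow_succ]
      linear_combination this
  have h := hk p
  rw [CharP.cast_eq_zero, sub_zero, (hp.odd_of_ne_two (by omega)).neg_one_pow] at h
  have : 2 * f x = 0 := by linear_combination h
  exact (mul_eq_zero.1 this).resolve_left (two_ne_zero_zmod hp3)

/-- The factor 2 is 1/2^(p-2) by Fermat, so the bracket is E_{p-2}(-x) modulo p. The two sides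
satisfy the same difference equation. -/
theorem derivative_scaledSum_eval (hp3 : 3 < p) (x : ZMod p) :
    eval x (derivative (scaledSum (X : (ZMod p)[X]) ((p - 1) / 2))) =
      -(((p - 1) / 2).factorial : ZMod p) ^ 2 *
        (2 * scaledEuler (p - 2) (2 * (-x) - 1)) := by
  have hp : p.Prime := Fact.out
  set n := (p - 1) / 2
  set N := (n.factorial : ZMod p) ^ 2
  rw [← sub_eq_zero]
  refine eq_zero_of_add_sub_one_eq_zero hp3 (fun x =>
    eval x (derivative (scaledSum (X : (ZMod p)[X]) n)) -
      -N * (2 * scaledEuler (p - 2) (2 * (-x) - 1))) (fun x => ?_) x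
  have hG := congrArg (fun q => eval x (derivative q))
    (scaledSum_add_scaledSum_sub_one (X : (ZMod p)[X]) n)
  have hcomp : scaledSum (X - 1 : (ZMod p)[X]) n = (scaledSum (X : (ZMod p)[X]) n).comp (X - 1) := by
    simpa using (map_scaledSum (compRingHom (X - 1 : (ZMod p)[X])) X n).symm
  have hQ : oddProd (X : (ZMod p)[X]) n = C N * (1 - X ^ (p - 1)) := oddProd_X_eq hp3
  have hp1 : ((p - 1 : ℕ) : ZMod p) = -1 := by
    rw [Nat.cast_sub hp.one_le]; simp
  simp only [hcomp, hQ, derivative_add, derivative_comp, eval_add, eval_mul,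
    derivative_mul, derivative_sub, derivative_X_pow, derivative_C, derivative_X, derivative_one,
    eval_sub, eval_comp, eval_X, eval_one, eval_C, eval_pow, derivative_ofNat, hp1,
    eval_ofNat, eval_zero, Nat.sub_sub, Nat.reduceAdd] at hG
  have hodd : Odd (p - 2) := by
    obtain ⟨k, hk⟩ := hp.odd_of_ne_two (by omega)
    exact ⟨k - 1, by omega⟩
  have hE := scaledEuler_add_one_add_sub_one (p - 2) (2 * (-x))
  have h2 : 2 * (2 * (-x)) ^ (p - 2) * 2 = -(2 * x ^ (p - 2)) := by
    rw [mul_pow, Odd.neg_pow hodd]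
    linear_combination -2 * x ^ (p - 2) * two_pow_sub_two_mul_two hp3
  rw [show 2 * -(x - 1) - 1 = 2 * (-x) + 1 by ring]
  linear_combination hG + 2 * N * hE + N * h2

theorem derivative_chooseProd_eval (hp3 : 3 < p) (x : ZMod p) :
    eval x (derivative (chooseProd (X : (ZMod p)[X]) ((p - 1) / 2 + 1))) =
      -(((p - 1) / 2).factorial : ZMod p) ^ 2 * ((2 * x + 1) / 2) := by
  have hp : p.Prime := Fact.out
  set n := (p - 1) / 2
  set N := (n.factorial : ZMod p) ^ 2
  have hQ : oddProd (X : (ZMod p)[X]) n = C N * (1 - X ^ (p - 1)) := oddProd_X_eq hp3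
  have hn : 2 * ((n : ZMod p) + 1) = 1 := by
    have : ((2 * n + 1 : ℕ) : ZMod p) = 0 := by
      rw [two_mul_half_add_one hp hp3, CharP.cast_eq_zero]
    push_cast at this
    linear_combination this
  -- At every point X - X^p vanishes and has derivative 1, so the derivative of the product is -N(x
  -- + n + 1), where n + 1 = 1/2 modulo p.
  have hW : chooseProd (X : (ZMod p)[X]) (n + 1) = C (-N) * ((X - X ^ p) * (X + C (n + 1 : ZMod p))) := by
    rw [chooseProd_succ_eq_oddProd, hQ]
    have hX : (X : (ZMod p)[X]) ^ p = X ^ (p - 1) * X := by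
      rw [← pow_succ, Nat.sub_add_cancel hp.one_le]
    rw [hX]
    simp only [C_neg, C_add, C_1, C_eq_natCast]
    ring
  rw [hW]
  simp only [derivative_mul, derivative_C, derivative_sub, derivative_add, derivative_X,
    derivative_X_pow, eval_add, eval_mul, eval_sub, eval_C, eval_X, eval_pow, eval_zero, eval_one,
    CharP.cast_eq_zero, C_0, ZMod.pow_card]
  field_simp [two_ne_zero_zmod hp3]
  linear_combination -N * hn

end ModPrime

/-! ### Rational p-adic integers and the expansion modulo p² -/

section PInt

variable (p : ℕ) [Fact p.Prime]

theorem isPInt_iff {p : ℕ} {x : ℚ} : IsPInt p x ↔ (x.den : ZMod p) ≠ 0 := by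
  rw [IsPInt, Ne, ZMod.natCast_eq_zero_iff]

theorem IsPInt.of_den_dvd {p : ℕ} {x : ℚ} {d : ℕ} (hd : ¬ p ∣ d) (h : x.den ∣ d) : IsPInt p x :=
  fun hx => hd (hx.trans h)

/-- The ring of rational `p`-adic integers. -/
def pIntegers : Subring ℚ where
  carrier := {x | IsPInt p x}
  mul_mem' {x y} hx hy := IsPInt.of_den_dvd
    ((Nat.Prime.dvd_mul Fact.out).not.2 (not_or.2 ⟨hx, hy⟩)) (Rat.mul_den_dvd x y)
  one_mem' := by simp [IsPInt, (Fact.out : p.Prime).one_lt.ne']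
  add_mem' {x y} hx hy := IsPInt.of_den_dvd
    ((Nat.Prime.dvd_mul Fact.out).not.2 (not_or.2 ⟨hx, hy⟩)) (Rat.add_den_dvd x y)
  zero_mem' := by simp [IsPInt, (Fact.out : p.Prime).one_lt.ne']
  neg_mem' {x} hx := by simpa [IsPInt] using hx

variable {p}

theorem natCast_inv_mem_pIntegers {k : ℕ} (hk : ¬ p ∣ k) : (k : ℚ)⁻¹ ∈ pIntegers p :=
  IsPInt.of_den_dvd hk (by
    rcases Nat.eq_zero_or_pos k with rfl | h
    · simp
    · rw [Rat.inv_natCast_den_of_pos h])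

theorem coe_two_pIntegers : ((2 : pIntegers p) : ℚ) = 2 := rfl

variable (p) in
/-- Reduction modulo `p` of rational `p`-adic integers. -/
def reduction : pIntegers p →+* ZMod p where
  toFun x := ((x : ℚ) : ZMod p)
  map_one' := by simp
  map_zero' := by simp
  map_mul' x y := Rat.cast_mul_of_ne_zero (isPInt_iff.1 x.2) (isPInt_iff.1 y.2)
  map_add' x y := Rat.cast_add_of_ne_zero (isPInt_iff.1 x.2) (isPInt_iff.1 y.2)

theorem exists_eq_mul_of_reduction_eq_zero {x : pIntegers p} (h : reduction p x = 0) :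
    ∃ y : pIntegers p, x = p * y := by
  have h0 : (((x : ℚ).num : ZMod p)) = 0 := by
    have h1 : (((x : ℚ).num : ZMod p) / ((x : ℚ).den : ZMod p)) = 0 := by
      rw [← Rat.cast_def]; exact h
    exact (div_eq_zero_iff.1 h1).resolve_right (isPInt_iff.1 x.2)
  obtain ⟨c, hc⟩ := (ZMod.intCast_zmod_eq_zero_iff_dvd _ p).1 h0
  refine ⟨⟨c * ((x : ℚ).den : ℚ)⁻¹, mul_mem (intCast_mem _ c) (natCast_inv_mem_pIntegers x.2)⟩, ?_⟩
  ext
  have h2 : (x : ℚ) = (x : ℚ).num / (x : ℚ).den := (Rat.num_div_den _).symm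
  rw [hc] at h2
  push_cast at h2 ⊢
  rw [← div_eq_mul_inv, ← mul_div_assoc]
  exact h2

/-- Expansion of the weighted sum modulo `p ^ 2` around an integer `m`. -/
theorem congr_of_expansion (hp3 : 3 < p) (m : ℤ) (s : ℤ)
    (hG : scaledSum m ((p - 1) / 2) = (((p - 1) / 2).factorial : ℤ) ^ 2 * s)
    (hW : chooseProd m ((p - 1) / 2 + 1) = 0) (a t : ℚ) (ht : IsPInt p t) (hat : a = m + p * t) :
    Congr p (p ^ 2)
      (∑ k ∈ range ((p - 1) / 2 + 1), (k : ℚ) * Ring.choose a k * Ring.choose (-1 - a) k)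
      (s * a * (a + 1) -
        1 / 2 * p * t * (2 * a * (a + 1) * eulerPoly (p - 2) (-a) + 2 * a + 1)) := by
  have hp : p.Prime := Fact.out
  set n := (p - 1) / 2
  set T : pIntegers p := ⟨t, ht⟩
  have hp2 : ¬ p ∣ 2 := fun h => absurd (Nat.le_of_dvd two_pos h) (by omega)
  let half : pIntegers p := ⟨((2 : ℕ) : ℚ)⁻¹, natCast_inv_mem_pIntegers hp2⟩
  have hhalf : 2 * half = 1 := by ext; simp [half, coe_two_pIntegers]
  have hfac : ¬ p ∣ n.factorial ^ 2 := fun h =>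
    absurd ((hp.dvd_factorial).1 (hp.dvd_of_dvd_pow h)) (by omega)
  let I : pIntegers p := ⟨((n.factorial ^ 2 : ℕ) : ℚ)⁻¹, natCast_inv_mem_pIntegers hfac⟩
  set N : pIntegers p := (n.factorial : pIntegers p) ^ 2 with hN
  have hI : I * N = 1 := by
    ext
    have : (n.factorial : ℚ) ≠ 0 := by exact_mod_cast n.factorial_ne_zero
    simp [I, N, this]
  set A : pIntegers p := m + p * T with hA
  have hAa : (A : ℚ) = a := by simp [hA, hat, T]
  set E : pIntegers p := half ^ (p - 2) * scaledEuler (p - 2) (2 * (-A) - 1) with hE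
  have hEa : (E : ℚ) = eulerPoly (p - 2) (-a) := by
    have := map_scaledEuler (pIntegers p).subtype (p - 2) (2 * (-A) - 1)
    simp only [Subring.subtype_apply] at this
    rw [hE, eulerPoly_eq]
    push_cast
    rw [this]
    simp [half, hAa, coe_two_pIntegers]
  have hFa : ((scaledWeightedSum A n : pIntegers p) : ℚ) = (n.factorial : ℚ) ^ 2 *
      ∑ k ∈ range (n + 1), (k : ℚ) * Ring.choose a k * Ring.choose (-1 - a) k := by
    rw [← scaledWeightedSum_eq_sum, ← hAa]
    exact map_scaledWeightedSum (pIntegers p).subtype A n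
  -- Taylor's formula at m with increment pT; c is the coefficient of the quadratic remainder.
  obtain ⟨c, hc⟩ := (scaledWeightedSum (X : (pIntegers p)[X]) n).binomExpansion m (p * T)
  set D := eval (m : pIntegers p) (derivative (scaledWeightedSum (X : (pIntegers p)[X]) n))
  have heval (x : pIntegers p) : eval x (scaledWeightedSum (X : (pIntegers p)[X]) n) =
      scaledWeightedSum x n := by
    simpa using map_scaledWeightedSum (evalRingHom x) X n
  have hGm : scaledSum (m : pIntegers p) n = N * s := by
    have := congrArg (Int.castRingHom (pIntegers p)) hG
    rw [map_scaledSum] at this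
    simpa [N] using this
  have hWm : chooseProd (m : pIntegers p) (n + 1) = 0 := by
    have := congrArg (Int.castRingHom (pIntegers p)) hW
    rw [map_chooseProd] at this
    simpa using this
  rw [heval, heval, ← hA, scaledWeightedSum_eq (m : pIntegers p) n, hGm, hWm] at hc
  -- B is the coefficient of pT in F(A) minus N times the target; 2m + 1 comes from expanding A(A+1)
  -- around m. It remains to see that p divides B.
  set B := D - N * s * (2 * m + 1) + half * N * (2 * A * (A + 1) * E + 2 * A + 1) with hB
  have hDred : reduction p D = eval (m : ZMod p)
      (derivative (scaledWeightedSum (X : (ZMod p)[X]) n)) := by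
    have h1 := map_scaledWeightedSum (mapRingHom (reduction p)) X n
    rw [coe_mapRingHom, map_X] at h1
    rw [← h1, derivative_map, ← map_intCast (reduction p), eval_map_apply]
  have hdG : eval (m : ZMod p) (derivative (scaledSum (X : (ZMod p)[X]) n)) =
      -(n.factorial : ZMod p) ^ 2 * (2 * scaledEuler (p - 2) (2 * (-(m : ZMod p)) - 1)) :=
    derivative_scaledSum_eval hp3 _
  have hdW : eval (m : ZMod p) (derivative (chooseProd (X : (ZMod p)[X]) (n + 1))) =
      -(n.factorial : ZMod p) ^ 2 * ((2 * m + 1) / 2) := derivative_chooseProd_eval hp3 _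
  have hGp : eval (m : ZMod p) (scaledSum (X : (ZMod p)[X]) n) = (n.factorial : ZMod p) ^ 2 * s := by
    have h1 := congrArg (Int.castRingHom (ZMod p)) hG
    have h2 := map_scaledSum (evalRingHom (m : ZMod p)) X n
    rw [map_scaledSum] at h1
    simp only [coe_evalRingHom, eval_X] at h2
    simpa [h2] using h1
  have h2p := two_ne_zero_zmod (p := p) hp3
  have hhalfp : reduction p half = 1 / 2 := by
    rw [eq_div_iff h2p, mul_comm]
    simpa only [map_mul, map_ofNat, map_one] using congrArg (reduction p) hhalf
  have hEp : reduction p E = 2 * scaledEuler (p - 2) (2 * (-(m : ZMod p)) - 1) := by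
    have h1 : (1 / 2 : ZMod p) ^ (p - 2) = 2 := by
      rw [div_pow, one_pow, div_eq_iff (pow_ne_zero _ h2p), mul_comm]
      exact (two_pow_sub_two_mul_two hp3).symm
    rw [hE, map_mul, map_pow, hhalfp, h1, map_scaledEuler]
    simp only [hA, map_sub, map_mul, map_neg, map_add, map_ofNat, map_one, map_natCast, map_intCast,
      CharP.cast_eq_zero, zero_mul, add_zero]
  have hBred : reduction p B = 0 := by
    have hAp : reduction p A = m := by simp [hA]
    have hNp : reduction p N = (n.factorial : ZMod p) ^ 2 := by simp [hN]
    simp only [hB, map_add, map_sub, map_mul, hDred, hhalfp, hEp, hAp, hNp, map_ofNat, map_one,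
      map_intCast]
    rw [scaledWeightedSum_eq]
    simp only [derivative_add, derivative_mul, derivative_X, derivative_one, eval_add, eval_mul,
      eval_X, eval_one, eval_zero, hdG, hdW, hGp]
    field_simp
    ring
  obtain ⟨b, hb⟩ := exists_eq_mul_of_reduction_eq_zero hBred
  set L : pIntegers p := s * A * (A + 1) - half * p * T * (2 * A * (A + 1) * E + 2 * A + 1) with hL
  -- The three terms come from B = pb, from the Taylor remainder, and from the square of pT in
  -- A(A+1).
  have key : scaledWeightedSum A n - N * L = p ^ 2 * (T * b + c * T ^ 2 - N * s * T ^ 2) := by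
    rw [hB] at hb
    rw [hL]
    linear_combination hc + p * T * hb - N * s * (A + m + p * T + 1) * hA
  have hS : ∑ k ∈ range (n + 1), (k : ℚ) * Ring.choose a k * Ring.choose (-1 - a) k =
      ((I * scaledWeightedSum A n : pIntegers p) : ℚ) := by
    rw [Subring.coe_mul, hFa]
    have : (n.factorial : ℚ) ≠ 0 := by exact_mod_cast n.factorial_ne_zero
    simp only [I]
    push_cast
    field_simp
  have hLa : (L : ℚ) = s * a * (a + 1) -
        1 / 2 * p * t * (2 * a * (a + 1) * eulerPoly (p - 2) (-a) + 2 * a + 1) := by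
    rw [hL]
    push_cast
    rw [hAa, hEa]
    simp [half, T, coe_two_pIntegers]
  rw [hS, ← hLa]
  refine ⟨Subtype.property _, Subtype.property _, _,
    (I * (T * b + c * T ^ 2 - N * s * T ^ 2) : pIntegers p).2, ?_⟩
  have : I * scaledWeightedSum A n - L = ((p ^ 2 : ℕ) : pIntegers p) *
      (I * (T * b + c * T ^ 2 - N * s * T ^ 2)) := by
    push_cast
    linear_combination I * key + L * hI
  exact_mod_cast congrArg (Subtype.val) this

end PInt
end SunCongruence

/-! ### The two cases: choice of the expansion point -/

theorem theorem3p4 (p : ℕ) (hp : p.Prime) (hp3 : 3 < p)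
    (a : ℚ) (ha : SunCongruence.IsPInt p a) (ha0 : ¬ SunCongruence.Congr p p a 0)
    (t : ℚ) (ht : t = (a - SunCongruence.residue p a) / p) :
    (SunCongruence.residue p a ≤ (p - 1) / 2 →
      SunCongruence.Congr p (p ^ 2)
        (∑ k ∈ Finset.range ((p - 1) / 2 + 1),
          (k : ℚ) * Ring.choose a k * Ring.choose (-1 - a) k)
        ((-1) ^ SunCongruence.residue p a * a * (a + 1)
          - 1 / 2 * p * t *
            (2 * a * (a + 1) * SunCongruence.eulerPoly (p - 2) (-a) + 2 * a + 1))) ∧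
    ((p - 1) / 2 < SunCongruence.residue p a →
      SunCongruence.Congr p (p ^ 2)
        (∑ k ∈ Finset.range ((p - 1) / 2 + 1),
          (k : ℚ) * Ring.choose a k * Ring.choose (-1 - a) k)
        ((-1) ^ SunCongruence.residue p a * a * (a + 1)
          - 1 / 2 * p * (t + 1) *
            (2 * a * (a + 1) * SunCongruence.eulerPoly (p - 2) (-a) + 2 * a + 1))) := by
  open SunCongruence in
  have : Fact p.Prime := ⟨hp⟩
  have hlt := residue_lt p hp a
  obtain ⟨-, -, c, hc, hac⟩ := congr_residue p hp a ha
  have hp0 : (p : ℚ) ≠ 0 := by exact_mod_cast hp.ne_zero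
  have htc : t = c := by rw [ht, hac, mul_div_cancel_left₀ _ hp0]
  subst htc
  have hn := two_mul_half_add_one hp hp3
  generalize residue p a = m at *
  constructor
  · intro hm
    have h := congr_of_expansion hp3 (m : ℤ) ((-1) ^ m) (scaledSum_natCast hm)
      (chooseProd_natCast_eq_zero (by omega)) a t hc (by push_cast; linear_combination hac)
    exact_mod_cast h
  · intro hm
    -- For a large residue the expansion point is m - p = -1 - r, which turns t into t + 1. The
    -- symmetry x ↦ -1 - x carries it to r < (p-1)/2, where the exact values are known; r + m = p -
    -- 1 is even, so the sign is unchanged.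
    obtain ⟨r, hr⟩ : ∃ r, r + m + 1 = p := ⟨p - 1 - m, by omega⟩
    have hrn : r < (p - 1) / 2 := by omega
    have hneg : ((m : ℤ) - p) = -1 - (r : ℤ) := by rw [← hr]; push_cast; ring
    have hsign : (-1 : ℤ) ^ r = (-1) ^ m := by
      have : Even (r + m) := ⟨(p - 1) / 2, by omega⟩
      rw [Nat.even_add] at this
      by_cases hm : Even m
      · rw [hm.neg_one_pow, (this.2 hm).neg_one_pow]
      · rw [(Nat.not_even_iff_odd.1 hm).neg_one_pow,
          (Nat.not_even_iff_odd.1 (this.not.2 hm)).neg_one_pow]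
    have h := congr_of_expansion hp3 ((m : ℤ) - p) ((-1) ^ m)
      (by rw [hneg, scaledSum_neg_one_sub, scaledSum_natCast hrn.le, hsign])
      (by rw [hneg, chooseProd_neg_one_sub, chooseProd_natCast_eq_zero (by omega)]) a (t + 1)
      ((pIntegers p).add_mem hc (pIntegers p).one_mem) (by push_cast; linear_combination hac)
    exact_mod_cast h
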